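/- Let $k\ge 1$. A $k$-graph is a countable small category $\Lambda$ with a functor $d:\Lambda\to\mathbb N^k$ such that whenever $d(\lambda)=m+n$ there are unique morphisms $\mu,\nu$ with $d(\mu)=m$, $d(\nu)=n$ and $\lambda=\mu\nu$. Write $r(\lambda)$ and $s(\lambda)$ for the codomain and domain of $\lambda$, $\Lambda^0$ for the set of objects, and $v\Lambda^n=\{\lambda : r(\lambda)=v,\ d(\lambda)=n\}$. Let $e_1,\dots,e_k$ be the generators of $\mathbb N^k$, and let $\le$ and $\wedge$ be the coordinatewise order and minimum. $\Lambda$ is row-finite if every $v\Lambda^n$ ($v\in\Lambda^0$, $n\in\mathbb N^k$) is finite, and locally convex if for all $i\ne j$, $\lambda\in v\Lambda^{e_i}$ and $\mu\in v\Lambda^{e_j}$ both $s(\lambda)\Lambda^{e_j}$ and $s(\mu)\Lambda^{e_i}$ are non-empty. For $m\in(\mathbb N\cup\{\infty\})^k$ let $\Omega_{k,m}$ be the category with objects $\{p\in\mathbb N^k: p\le m\}$ and exactly one morphism $(p,q)$, with domain $q$ and codomain $p$ and of degree $q-p$, for each $p\le q\le m$. A boundary path of $\Lambda$ is a degree-preserving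 functor $x:\Omega_{k,m}\to\Lambda$ such that $x(p)\Lambda^{e_i}=\emptyset$ whenever $p\le m$ and $p_i=m_i$. Put $d(x)=m$ and $r(x)=x(0)$, and let $v\Lambda^{\le\infty}$ be the set of boundary paths $x$ with $r(x)=v$. For $n\in\mathbb N^k$ with $n\le d(x)$ let $\sigma^n(x):\Omega_{k,d(x)-n}\to\Lambda$ be the boundary path $\sigma^n(x)(p,q)=x(p+n,q+n)$. **Lemma.** Let $\Lambda$ be a row-finite locally convex $k$-graph. The following are equivalent: (a) there exist $v\in\Lambda^0$ and $m\neq n$ in $\mathbb N^k$ such that $\Lambda$ has local periodicity $m,n$ at $v$, that is, for every $x\in v\Lambda^{\le\infty}$ we have $m-m\wedge d(x)=n-n\wedge d(x)$ and $\sigma^{m\wedge d(x)}(x)=\sigma^{n\wedge d(x)}(x)$; (b) there exist $w\in\Lambda^0$ and $p\neq q$ in $\mathbb N^k$ such that for every $x\in w\Lambda^{\le\infty}$ we have $p,q\le d(x)$ and $\sigma^p(x)=\sigma^q(x)$. Consequently $\Lambda$ has no local periodicity (that is, (a) fails for all $v$ and all $m\ne n$) if and only if there are no $w\in\Lambda^0$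 and $p\neq q$ as in (b). -/

import Mathlib

open CategoryTheory Opposite

universe v u

/-- The structure of a `k`-graph on a category `Λ`: `Λ` is countable and carries a degree functor
to `ℕ^k` with the factorisation property. A morphism `f : a ⟶ b` is a path with source `a` and
range `b`, so the product `μν` of paths is `ν ≫ μ`. Objects are the vertices. -/
structure KGraph (k : ℕ) (Λ : Type u) [Category.{v} Λ] where
  countable_mor : Countable (Σ a b : Λ, (a ⟶ b))
  deg : ∀ {a b : Λ}, (a ⟶ b) → (Fin k → ℕ)
  deg_id : ∀ a : Λ, deg (𝟙 a) = 0
  deg_comp : ∀ {a b c : Λ} (f : a ⟶ b) (g : b ⟶ c), deg (f ≫ g) = deg f + deg g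
  /-- If `d(λ) = m + n` there are unique paths `μ, ν` with `d(μ) = m`, `d(ν) = n`, `λ = μν`
  (the middle vertex is part of the uniqueness). -/
  factorisation : ∀ {a b : Λ} (f : a ⟶ b) (m n : Fin k → ℕ), deg f = m + n →
    ∃! t : Σ c : Λ, (c ⟶ b) × (a ⟶ c), deg t.2.1 = m ∧ deg t.2.2 = n ∧ t.2.2 ≫ t.2.1 = f

namespace KGraph

/-- The objects of `Ω_{k,m}`: the `p ∈ ℕ^k` with `p ≤ m`, where `m ∈ (ℕ ∪ {∞})^k`. -/
abbrev OmegaObj {k : ℕ} (m : Fin k → ℕ∞) : Type :=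
  {p : Fin k → ℕ // ∀ i, (p i : ℕ∞) ≤ m i}

/-- The category `Ω_{k,m}`. For `p ≤ q` it has exactly one morphism `(p, q)`, with domain `q` and
codomain `p`; hence it is the opposite of the poset `{p ∈ ℕ^k : p ≤ m}`. -/
abbrev Omega {k : ℕ} (m : Fin k → ℕ∞) : Type := (OmegaObj m)ᵒᵖ

/-- The coordinatewise minimum `m ∧ d ∈ ℕ^k` of `m ∈ ℕ^k` and `d ∈ (ℕ ∪ {∞})^k`. -/
noncomputable def meet {k : ℕ} (m : Fin k → ℕ) (d : Fin k → ℕ∞) : Fin k → ℕ :=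
  fun i => (min (m i : ℕ∞) (d i)).toNat

theorem coe_meet {k : ℕ} (m : Fin k → ℕ) (d : Fin k → ℕ∞) (i : Fin k) :
    (meet m d i : ℕ∞) = min (m i : ℕ∞) (d i) :=
  ENat.natCast_toNat (ne_top_of_le_ne_top (ENat.natCast_ne_top (m i)) (min_le_left _ _))

theorem meet_le {k : ℕ} (m : Fin k → ℕ) (d : Fin k → ℕ∞) (i : Fin k) :
    (meet m d i : ℕ∞) ≤ d i := by
  rw [coe_meet]; exact min_le_right _ _

/-- If `p ≤ d - n` and `n ≤ d` then `p + n ≤ d`. -/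
theorem add_le_of_le_sub {k : ℕ} {d : Fin k → ℕ∞} {n : Fin k → ℕ}
    (hn : ∀ i, (n i : ℕ∞) ≤ d i) (p : OmegaObj (fun i => d i - (n i : ℕ∞))) (i : Fin k) :
    (((p.1 + n) i : ℕ) : ℕ∞) ≤ d i := by
  rw [Pi.add_apply, Nat.cast_add]
  calc (p.1 i : ℕ∞) + n i ≤ (d i - n i) + n i := by gcongr; exact p.2 i
    _ = d i := tsub_add_cancel_of_le (hn i)

/-- Translation by `n`, as a map from the objects of `Ω_{k,d-n}` to those of `Ω_{k,d}`. -/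
def translate {k : ℕ} {d : Fin k → ℕ∞} {n : Fin k → ℕ} (hn : ∀ i, (n i : ℕ∞) ≤ d i) :
    OmegaObj (fun i => d i - (n i : ℕ∞)) → OmegaObj d :=
  fun p => ⟨p.1 + n, add_le_of_le_sub hn p⟩

theorem translate_mono {k : ℕ} {d : Fin k → ℕ∞} {n : Fin k → ℕ}
    (hn : ∀ i, (n i : ℕ∞) ≤ d i) : Monotone (translate hn) :=
  fun _ _ h => Subtype.mk_le_mk.mpr (add_le_add_left (Subtype.coe_le_coe.mpr h) n)

section

variable {k : ℕ} {Λ : Type u} [Category.{v} Λ] (G : KGraph k Λ)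

/-- `vΛ^n`: the paths of degree `n` with range `v`. -/
def pathsTo (v : Λ) (n : Fin k → ℕ) : Set (Σ w : Λ, (w ⟶ v)) :=
  {l | G.deg l.2 = n}

/-- Row finite: every `vΛ^n` is finite. -/
def RowFinite : Prop :=
  ∀ (v : Λ) (n : Fin k → ℕ), (G.pathsTo v n).Finite

/-- Locally convex: for `i ≠ j` and `λ ∈ Λ^{e_i}`, `μ ∈ Λ^{e_j}` with `r(λ) = r(μ)`, the sets
`s(λ)Λ^{e_j}` and `s(μ)Λ^{e_i}` are non-empty. -/
def LocallyConvex : Prop :=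
  ∀ (i j : Fin k), i ≠ j → ∀ (v a b : Λ) (l : a ⟶ v) (m : b ⟶ v),
    G.deg l = Pi.single i 1 → G.deg m = Pi.single j 1 →
      (G.pathsTo a (Pi.single j 1)).Nonempty ∧ (G.pathsTo b (Pi.single i 1)).Nonempty

/-- Boundary paths of `Λ`: degree-preserving functors `x : Ω_{k,m} → Λ`, with `m = d(x)`, such that
`x(p)Λ^{e_i} = ∅` whenever `p ≤ m` and `p_i = m_i`. Two boundary paths are equal iff their degrees
and the functors agree. -/
structure BoundaryPath where
  degree : Fin k → ℕ∞
  toFunctor : Omega degree ⥤ Λ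
  deg_map : ∀ {p q : OmegaObj degree} (h : p ≤ q),
    G.deg (toFunctor.map (homOfLE h).op) = q.1 - p.1
  boundary : ∀ (p : OmegaObj degree) (i : Fin k), (p.1 i : ℕ∞) = degree i →
    G.pathsTo (toFunctor.obj (op p)) (Pi.single i 1) = ∅

variable {G}

/-- The range `r(x) = x(0)`. -/
def BoundaryPath.range (x : G.BoundaryPath) : Λ :=
  x.toFunctor.obj (op ⟨0, fun _ => zero_le⟩)

/-- The shift `σ^n(x) : Ω_{k,d(x)-n} → Λ`, `σ^n(x)(p,q) = x(p+n,q+n)`, for `n ≤ d(x)`. -/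
def BoundaryPath.shift (x : G.BoundaryPath) (n : Fin k → ℕ)
    (hn : ∀ i, (n i : ℕ∞) ≤ x.degree i) : G.BoundaryPath where
  degree := fun i => x.degree i - (n i : ℕ∞)
  toFunctor := (translate_mono hn).functor.op ⋙ x.toFunctor
  deg_map := by
    intro p q h
    refine (x.deg_map (translate_mono hn h)).trans ?_
    funext i
    simp [translate, Nat.add_sub_add_right]
  boundary := by
    intro p i hi
    refine x.boundary (translate hn p) i ?_
    change (((p.1 + n) i : ℕ) : ℕ∞) = x.degree i
    rw [Pi.add_apply, Nat.cast_add, hi]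
    exact tsub_add_cancel_of_le (hn i)

variable (G)

/-- `Λ` has local periodicity `m, n` at `w`: every boundary path `x` with range `w` satisfies
`m - m ∧ d(x) = n - n ∧ d(x)` and `σ^{m ∧ d(x)}(x) = σ^{n ∧ d(x)}(x)`. -/
def LocalPeriodicityAt (m n : Fin k → ℕ) (w : Λ) : Prop :=
  ∀ x : G.BoundaryPath, x.range = w →
    m - meet m x.degree = n - meet n x.degree ∧
    x.shift (meet m x.degree) (meet_le m x.degree) =
      x.shift (meet n x.degree) (meet_le n x.degree)

/-- `Λ` has no local periodicity. -/
def NoLocalPeriodicity : Prop :=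
  ∀ (w : Λ) (m n : Fin k → ℕ), m ≠ n → ¬ G.LocalPeriodicityAt m n w

/-- The stricter condition: every boundary path `x` with range `w` satisfies `p, q ≤ d(x)` and
`σ^p(x) = σ^q(x)`. -/
def StrictPeriodicityAt (p q : Fin k → ℕ) (w : Λ) : Prop :=
  ∀ x : G.BoundaryPath, x.range = w →
    ∃ (hp : ∀ i, (p i : ℕ∞) ≤ x.degree i) (hq : ∀ i, (q i : ℕ∞) ≤ x.degree i),
      x.shift p hp = x.shift q hq

end

end KGraph

/-!
Strict periodicity `σ^p(x) = σ^q(x)` with `p, q ≤ d(x)` is local periodicity, because then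
`p ∧ d(x) = p` and `q ∧ d(x) = q`.

Conversely, suppose that `Λ` has local periodicity `m, n` at `v`. In the coordinates where `m` and
`n` differ, `m - m ∧ d(x) = n - n ∧ d(x)` forces `m i, n i ≤ d(x) i`, so only the coordinates where
they agree can be truncated. These are disposed of by a path `l` into `v` whose degree `a` is
maximal below `c`, where `c i = m i` if `m i = n i` and `c i = 0` otherwise. If `a i < c i`, then by
maximality the source `w` of `l` receives no path of degree `e_i`, so every boundary path with range
`w` has degree `0` in direction `i`. With `p` and `q` the restrictions of `m` and `n` to the
coordinates where they differ, it follows that `m ∧ d(ly) = a + p` and `n ∧ d(ly) = a + q` for every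
boundary path `y` with range `w`, and therefore `σ^p(y) = σ^{a+p}(ly) = σ^{a+q}(ly) = σ^q(y)`.

What has to be built is the boundary path `ly` (`BoundaryPath.exists_shift_eq`). Its initial segment of degree
`p` is the initial segment of degree `p` of the path `l y(0, p ∨ a - a)`, and the factorisation property
makes these cohere into a functor. Local convexity enters in the proof that `ly` satisfies the
boundary condition: a path of degree `e_i` into `(ly)(p)` yields one into
`(ly)(p ∨ a) = y(p ∨ a - a)` (`LocallyConvex.pathsTo_nonempty`).
-/

namespace KGraph

variable {k : ℕ} {Λ : Type u} [Category.{v} Λ] {G : KGraph k Λ}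

/-! ### Initial segments of paths -/

/-- Paths can be cancelled in a `k`-graph; hence the `θ` with `f = gθ` is determined by `f`
and `g`. -/
theorem cancel_right (G : KGraph k Λ) {a b c : Λ} {f f' : a ⟶ b} {g : b ⟶ c}
    (h : f ≫ g = f' ≫ g) : f = f' := by
  have hd : G.deg f' = G.deg f := by
    have := congrArg G.deg h
    rw [G.deg_comp, G.deg_comp] at this
    exact (add_right_cancel this).symm
  have key := (G.factorisation (f ≫ g) (G.deg g) (G.deg f)
    (by rw [G.deg_comp, add_comm])).unique (y₁ := ⟨b, g, f⟩) (y₂ := ⟨b, g, f'⟩)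
    ⟨rfl, rfl, rfl⟩ ⟨rfl, hd, h.symm⟩
  simpa using key

/-- The path `g` is an initial segment of `f`: `f = gθ` for some path `θ`. Paths with range `v` are
bundled with their source. -/
def Prefix {v : Λ} (g f : Σ w : Λ, (w ⟶ v)) : Prop :=
  ∃ θ : f.1 ⟶ g.1, θ ≫ g.2 = f.2

theorem Prefix.refl {v : Λ} (f : Σ w : Λ, (w ⟶ v)) : Prefix f f :=
  ⟨𝟙 _, Category.id_comp _⟩

theorem Prefix.trans {v : Λ} {f g h : Σ w : Λ, (w ⟶ v)} (hfg : Prefix f g) (hgh : Prefix g h) :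
    Prefix f h := by
  obtain ⟨θ, hθ⟩ := hfg
  obtain ⟨η, hη⟩ := hgh
  exact ⟨η ≫ θ, by rw [Category.assoc, hθ, hη]⟩

theorem exists_prefix (G : KGraph k Λ) {v : Λ} (f : Σ w : Λ, (w ⟶ v)) {m : Fin k → ℕ}
    (hm : m ≤ G.deg f.2) :
    ∃ g, Prefix g f ∧ G.deg g.2 = m := by
  obtain ⟨⟨c, g, θ⟩, ⟨h1, -, h3⟩, -⟩ :=
    G.factorisation f.2 m (G.deg f.2 - m) (add_tsub_cancel_of_le hm).symm
  exact ⟨⟨c, g⟩, ⟨θ, h3⟩, h1⟩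

theorem Prefix.eq_of_deg_eq {v : Λ} {f g g' : Σ w : Λ, (w ⟶ v)} (hg : Prefix g f)
    (hg' : Prefix g' f) (hd : G.deg g.2 = G.deg g'.2) : g = g' := by
  obtain ⟨w, f⟩ := f
  obtain ⟨c, g⟩ := g
  obtain ⟨c', g'⟩ := g'
  obtain ⟨θ, hθ⟩ := hg
  obtain ⟨θ', hθ'⟩ := hg'
  dsimp only at θ θ' hθ hθ' hd
  have h1 : G.deg θ + G.deg g = G.deg f := by rw [← hθ, G.deg_comp]
  have h2 : G.deg θ' + G.deg g' = G.deg f := by rw [← hθ', G.deg_comp]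
  have h3 : G.deg θ' = G.deg θ := by
    rw [← h1, hd] at h2
    exact add_right_cancel h2
  have key := (G.factorisation f (G.deg g) (G.deg θ) (by rw [← h1, add_comm])).unique
    (y₁ := ⟨c, g, θ⟩) (y₂ := ⟨c', g', θ'⟩) ⟨rfl, rfl, hθ⟩ ⟨hd.symm, h3, hθ'⟩
  cases key
  rfl

theorem Prefix.of_deg_le {v : Λ} {f g g' : Σ w : Λ, (w ⟶ v)} (hg : Prefix g f)
    (hg' : Prefix g' f) (hd : G.deg g.2 ≤ G.deg g'.2) : Prefix g g' := by
  obtain ⟨h, hh, hdeg⟩ := G.exists_prefix g' hd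
  rwa [← (hh.trans hg').eq_of_deg_eq hg hdeg]

theorem eq_id_of_deg_eq_zero {v : Λ} (f : Σ w : Λ, (w ⟶ v)) (h : G.deg f.2 = 0) :
    f = ⟨v, 𝟙 v⟩ :=
  (Prefix.refl f).eq_of_deg_eq (G := G) ⟨f.2, Category.comp_id _⟩ (by rw [h, G.deg_id])

/-! ### Transport of edges in a locally convex graph -/

/-- In a locally convex graph, if `z` receives a path of degree `e_i`, so does the source of every
path into `z` whose degree vanishes in direction `i`. -/
theorem LocallyConvex.pathsTo_nonempty (hconv : G.LocallyConvex) {i : Fin k} {u z : Λ} (f : u ⟶ z)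
    (hf : G.deg f i = 0) (hz : (G.pathsTo z (Pi.single i 1)).Nonempty) :
    (G.pathsTo u (Pi.single i 1)).Nonempty := by
  induction hN : ∑ j, G.deg f j using Nat.strong_induction_on generalizing u z with
  | _ N ih =>
    by_cases h0 : G.deg f = 0
    · cases eq_id_of_deg_eq_zero (G := G) ⟨u, f⟩ h0
      exact hz
    · obtain ⟨j, hj⟩ := Function.ne_iff.mp h0
      have hj : 0 < G.deg f j := Nat.pos_of_ne_zero hj
      have hij : i ≠ j := by rintro rfl; omega
      -- Split off the first edge, of degree `e_j`, move across it, and recurse on the rest.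
      obtain ⟨⟨c, g⟩, ⟨θ, hθ⟩, hg⟩ := G.exists_prefix ⟨u, f⟩ (m := Pi.single j 1) (by
        intro l
        rcases eq_or_ne l j with rfl | hl
        · simpa using Nat.succ_le_of_lt hj
        · simp [hl])
      dsimp only at θ hθ hg
      have hdeg : ∀ l, G.deg f l = G.deg θ l + (Pi.single j 1 : Fin k → ℕ) l := by
        intro l
        rw [← hθ, G.deg_comp, hg, Pi.add_apply]
      obtain ⟨⟨b, e⟩, he⟩ := hz
      have hc := (hconv i j hij z b c e g he hg).2
      refine ih (∑ l, G.deg θ l) ?_ θ ?_ hc rfl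
      · rw [← hN, Finset.sum_congr rfl fun l _ => hdeg l, Finset.sum_add_distrib]
        simp
      · have := hdeg i
        omega

/-! ### Boundary paths and their shifts -/

namespace BoundaryPath

/-- The degrees being only propositionally equal, the functors are compared value by value, over the
points of `ℕ^k` that lie below both degrees. -/
theorem ext_of_heq {x y : G.BoundaryPath} (hd : x.degree = y.degree)
    (hobj : ∀ (p : Fin k → ℕ) (hx : ∀ i, (p i : ℕ∞) ≤ x.degree i)
      (hy : ∀ i, (p i : ℕ∞) ≤ y.degree i),
      x.toFunctor.obj (op ⟨p, hx⟩) = y.toFunctor.obj (op ⟨p, hy⟩))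
    (hmap : ∀ (p q : Fin k → ℕ) (hpq : p ≤ q) (hx : ∀ i, (p i : ℕ∞) ≤ x.degree i)
      (hy : ∀ i, (p i : ℕ∞) ≤ y.degree i) (hx' : ∀ i, (q i : ℕ∞) ≤ x.degree i)
      (hy' : ∀ i, (q i : ℕ∞) ≤ y.degree i),
      (x.toFunctor.map (homOfLE (show (⟨p, hx⟩ : OmegaObj x.degree) ≤ ⟨q, hx'⟩ from hpq)).op) ≍
      (y.toFunctor.map (homOfLE (show (⟨p, hy⟩ : OmegaObj y.degree) ≤ ⟨q, hy'⟩ from hpq)).op)) :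
    x = y := by
  obtain ⟨d, F, h1, h2⟩ := x
  obtain ⟨d', F', h1', h2'⟩ := y
  dsimp only at hd
  subst hd
  have : F = F' := by
    refine CategoryTheory.Functor.hext (fun p => hobj p.unop.1 p.unop.2 p.unop.2) ?_
    intro q p f
    exact hmap p.unop.1 q.unop.1 (leOfHom f.unop) p.unop.2 p.unop.2 q.unop.2 q.unop.2
  subst this
  rfl

theorem map_heq (x : G.BoundaryPath) {p q p' q' : OmegaObj x.degree} (h : p ≤ q) (h' : p' ≤ q')
    (hp : p = p') (hq : q = q') :
    (x.toFunctor.map (homOfLE h).op) ≍ (x.toFunctor.map (homOfLE h').op) := by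
  subst hp hq
  rfl

/-- `σ^p(σ^a(x)) = σ^{a+p}(x)`; the exponent `b = a + p` is a variable so that the lemma applies to
meets, which equal such a sum only propositionally. -/
theorem shift_shift (x : G.BoundaryPath) (a p b : Fin k → ℕ) (ha : ∀ i, (a i : ℕ∞) ≤ x.degree i)
    (hp : ∀ i, (p i : ℕ∞) ≤ (x.shift a ha).degree i) (hb : ∀ i, (b i : ℕ∞) ≤ x.degree i)
    (h : b = a + p) : (x.shift a ha).shift p hp = x.shift b hb := by
  subst h
  have hsum : ∀ r : Fin k → ℕ, r + p + a = r + (a + p) := fun r => by abel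
  refine ext_of_heq ?_ ?_ ?_
  · funext i
    change x.degree i - (a i : ℕ∞) - (p i : ℕ∞) = x.degree i - ((a + p) i : ℕ)
    rw [Pi.add_apply, Nat.cast_add, tsub_tsub]
  · intro r hx hy
    exact congrArg (fun s => x.toFunctor.obj (op s)) (Subtype.ext (hsum r))
  · intro r s hrs hx hy hx' hy'
    exact x.map_heq _ _ (Subtype.ext (hsum r)) (Subtype.ext (hsum s))

theorem degree_eq_zero (x : G.BoundaryPath) {i : Fin k}
    (h : G.pathsTo x.range (Pi.single i 1) = ∅) : x.degree i = 0 := by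
  by_contra hne
  have hle : ∀ j, (((Pi.single i 1 : Fin k → ℕ) j : ℕ) : ℕ∞) ≤ x.degree j := by
    intro j
    rcases eq_or_ne j i with rfl | hj
    · simpa using Order.one_le_iff_pos.mpr (pos_iff_ne_zero.mpr hne)
    · simp [hj]
  have h0 : (⟨0, fun _ => zero_le⟩ : OmegaObj x.degree) ≤ ⟨Pi.single i 1, hle⟩ :=
    Subtype.mk_le_mk.mpr (fun _ => Nat.zero_le _)
  have hmem : (⟨_, x.toFunctor.map (homOfLE h0).op⟩ : Σ w : Λ, (w ⟶ x.range)) ∈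
      G.pathsTo x.range (Pi.single i 1) :=
    (x.deg_map h0).trans (tsub_zero _)
  rw [h] at hmem
  exact hmem

/-- The initial segment `x(0, p)`. -/
def initial (x : G.BoundaryPath) (p : OmegaObj x.degree) : Σ w : Λ, (w ⟶ x.range) :=
  ⟨x.toFunctor.obj (op p), x.toFunctor.map (homOfLE (show
    (⟨0, fun _ => zero_le⟩ : OmegaObj x.degree) ≤ p from fun _ => Nat.zero_le _)).op⟩

theorem deg_initial (x : G.BoundaryPath) (p : OmegaObj x.degree) :
    G.deg (x.initial p).2 = p.1 :=
  (x.deg_map _).trans (tsub_zero _)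

theorem map_comp_initial (x : G.BoundaryPath) {p q : OmegaObj x.degree} (h : p ≤ q) :
    x.toFunctor.map (homOfLE h).op ≫ (x.initial p).2 = (x.initial q).2 :=
  (x.toFunctor.map_comp _ _).symm

/-! ### Concatenation of a path and a boundary path -/

/-- The functor on `Ω_{k,D}` whose initial segments form a given coherent family of paths. -/
noncomputable def functorOfPrefixes (G : KGraph k Λ) {v : Λ} {D : Fin k → ℕ∞}
    (F : OmegaObj D → Σ w : Λ, (w ⟶ v)) (hF : ∀ {p q}, p ≤ q → Prefix (F p) (F q)) :
    Omega D ⥤ Λ where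
  obj p := (F p.unop).1
  map f := (hF (leOfHom f.unop)).choose
  map_id p := G.cancel_right (g := (F p.unop).2) <| by
    rw [Category.id_comp]
    exact (hF (leOfHom (𝟙 p : p ⟶ p).unop)).choose_spec
  map_comp {p q r} f g := G.cancel_right (g := (F r.unop).2) <| by
    rw [Category.assoc, (hF (leOfHom g.unop)).choose_spec, (hF (leOfHom f.unop)).choose_spec]
    exact (hF (leOfHom (f ≫ g).unop)).choose_spec

theorem functorOfPrefixes_map_comp {v : Λ} {D : Fin k → ℕ∞}
    (F : OmegaObj D → Σ w : Λ, (w ⟶ v)) (hF : ∀ {p q}, p ≤ q → Prefix (F p) (F q))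
    {p q : OmegaObj D} (h : p ≤ q) :
    (functorOfPrefixes G F hF).map (homOfLE h).op ≫ (F p).2 = (F q).2 :=
  (hF h).choose_spec

theorem heq_of_comp_eq (G : KGraph k Λ) {v : Λ} {f g f' g' : Σ w : Λ, (w ⟶ v)}
    (hf : f = f') (hg : g = g') {θ : f.1 ⟶ g.1} {θ' : f'.1 ⟶ g'.1} (h : θ ≫ g.2 = f.2)
    (h' : θ' ≫ g'.2 = f'.2) : θ ≍ θ' := by
  subst hf hg
  exact heq_of_eq (G.cancel_right (h.trans h'.symm))

/-- Every boundary path `y` with range the source of `l` is of the form `σ^{d(l)}(x)` for a boundary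
path `x`, namely `x = ly`, with range `r(l)`. -/
theorem exists_shift_eq (hconv : G.LocallyConvex) {v w : Λ} (y : G.BoundaryPath)
    (hy : y.range = w) (l : w ⟶ v) :
    ∃ (x : G.BoundaryPath) (h : ∀ i, (G.deg l i : ℕ∞) ≤ x.degree i),
      x.range = v ∧ x.shift (G.deg l) h = y := by
  subst hy
  set a := G.deg l with ha
  let D : Fin k → ℕ∞ := fun i => a i + y.degree i
  -- `p ∨ a - a`, written as the truncated difference `p - a`
  let R : OmegaObj D → OmegaObj y.degree := fun p => ⟨p.1 - a, fun i => by
    rw [Pi.sub_apply, ENat.natCast_sub]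
    exact tsub_le_iff_left.mpr (p.2 i)⟩
  have hR : ∀ {p q}, p ≤ q → R p ≤ R q := fun {p q} h i => Nat.sub_le_sub_right (h i) (a i)
  -- the paths `l y(0, p)`
  let E : OmegaObj y.degree → Σ w : Λ, (w ⟶ v) := fun p => ⟨(y.initial p).1, (y.initial p).2 ≫ l⟩
  have hEmap : ∀ {p q : OmegaObj y.degree} (h : p ≤ q),
      y.toFunctor.map (homOfLE h).op ≫ (E p).2 = (E q).2 := fun {p q} h =>
    (Category.assoc _ _ _).symm.trans (congrArg (· ≫ l) (y.map_comp_initial h))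
  have hE : ∀ {p q}, p ≤ q → Prefix (E p) (E q) := fun h => ⟨_, hEmap h⟩
  have hEdeg : ∀ p, G.deg (E p).2 = p.1 + a := fun p => by
    rw [G.deg_comp, y.deg_initial]
  have hex : ∀ p : OmegaObj D, ∃ g, Prefix g (E (R p)) ∧ G.deg g.2 = p.1 := fun p =>
    G.exists_prefix _ (by rw [hEdeg]; exact le_tsub_add)
  choose F hFE hFdeg using hex
  have hF : ∀ {p q}, p ≤ q → Prefix (F p) (F q) := fun {p q} h =>
    ((hFE p).trans (hE (hR h))).of_deg_le (G := G) (hFE q) (by rw [hFdeg, hFdeg]; exact h)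
  -- beyond `a`, the initial segments are those of `y` prolonged by `l`
  have hFeq : ∀ p : OmegaObj D, a ≤ p.1 → F p = E (R p) := fun p hp =>
    (hFE p).eq_of_deg_eq (G := G) (Prefix.refl _) (by
      rw [hFdeg, hEdeg]; exact (tsub_add_cancel_of_le hp).symm)
  have hmapdeg : ∀ {p q : OmegaObj D} (h : p ≤ q),
      G.deg ((functorOfPrefixes G F hF).map (homOfLE h).op) = q.1 - p.1 := fun {p q} h => by
    have h1 := (G.deg_comp _ _).symm.trans
      (congrArg G.deg (functorOfPrefixes_map_comp (G := G) F hF h))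
    exact eq_tsub_of_add_eq ((congrArg _ (hFdeg p).symm).trans (h1.trans (hFdeg q)))
  let x : G.BoundaryPath :=
    { degree := D
      toFunctor := functorOfPrefixes G F hF
      deg_map := hmapdeg
      boundary := by
        intro p i hpi
        by_contra hne
        have hai : a i ≤ p.1 i := by
          have : (a i : ℕ∞) ≤ p.1 i := hpi ▸ le_self_add
          exact_mod_cast this
        let q : OmegaObj D := ⟨p.1 ⊔ a, fun j => by
          rw [Pi.sup_apply]
          rcases max_choice (p.1 j) (a j) with h | h <;> rw [h]
          exacts [p.2 j, le_self_add]⟩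
        have hpq : p ≤ q := fun j => le_max_left _ _
        -- `p i` is already at least `a i`, so the path from `p` to `p ∨ a` has degree `0`
        -- in direction `i`
        have h1 := hconv.pathsTo_nonempty ((functorOfPrefixes G F hF).map (homOfLE hpq).op)
          (i := i) (by
            rw [hmapdeg hpq]
            change max (p.1 i) (a i) - p.1 i = 0
            omega) (Set.nonempty_iff_ne_empty.mpr hne)
        have h2 : (G.pathsTo (E (R q)).1 (Pi.single i 1)).Nonempty := by
          rw [← hFeq q (fun j => le_max_right _ _)]
          exact h1
        refine h2.ne_empty (y.boundary (R q) i ?_)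
        have h3 : (R q).1 i = p.1 i - a i := by
          change max (p.1 i) (a i) - a i = _
          omega
        rw [h3, ENat.natCast_sub, hpi]
        exact ENat.addLECancellable_of_ne_top (ENat.natCast_ne_top (a i)) |>.add_tsub_cancel_left }
  have hle : ∀ i, (a i : ℕ∞) ≤ x.degree i := fun i => le_self_add
  have hRt : ∀ (r : Fin k → ℕ) (h : ∀ i, ((r + a) i : ℕ) ≤ D i) (h' : ∀ i, (r i : ℕ∞) ≤ y.degree i),
      R ⟨r + a, h⟩ = ⟨r, h'⟩ := fun r h h' => Subtype.ext (add_tsub_cancel_right r a)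
  have hFr : ∀ (r : Fin k → ℕ) (h : ∀ i, ((r + a) i : ℕ) ≤ D i) (h' : ∀ i, (r i : ℕ∞) ≤ y.degree i),
      F ⟨r + a, h⟩ = E ⟨r, h'⟩ := fun r h h' => by
    rw [hFeq ⟨r + a, h⟩ (fun _ => Nat.le_add_left _ _), hRt r h h']
  refine ⟨x, hle, ?_, ?_⟩
  · change (F _).1 = v
    rw [eq_id_of_deg_eq_zero (G := G) (F _) (hFdeg _)]
  · refine ext_of_heq ?_ ?_ ?_
    · funext i
      exact ENat.addLECancellable_of_ne_top (ENat.natCast_ne_top (a i)) |>.add_tsub_cancel_left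
    · intro r hx hy
      exact congrArg Sigma.fst (hFr r _ hy)
    · intro r s hrs hx hy hx' hy'
      exact heq_of_comp_eq G (hFr s _ hy') (hFr r _ hy)
        (functorOfPrefixes_map_comp (G := G) F hF (translate_mono hle hrs)) (hEmap hrs)

end BoundaryPath

/-! ### Local periodicity and strict periodicity -/

theorem meet_eq_self {m : Fin k → ℕ} {d : Fin k → ℕ∞} (h : ∀ i, (m i : ℕ∞) ≤ d i) :
    meet m d = m := by
  funext i
  have := coe_meet m d i
  rw [min_eq_left (h i)] at this
  exact_mod_cast this

theorem StrictPeriodicityAt.localPeriodicityAt {p q : Fin k → ℕ} {w : Λ}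
    (h : G.StrictPeriodicityAt p q w) : G.LocalPeriodicityAt p q w := by
  intro x hx
  obtain ⟨hp, hq, heq⟩ := h x hx
  have h1 := meet_eq_self hp
  have h2 := meet_eq_self hq
  refine ⟨by rw [h1, h2, tsub_self, tsub_self], ?_⟩
  simpa only [h1, h2] using heq

/-- Where `m` and `n` differ, equal truncation defects mean that neither is truncated. -/
theorem le_of_sub_meet_eq {m n : Fin k → ℕ} {d : Fin k → ℕ∞}
    (h : m - meet m d = n - meet n d) {i : Fin k} (hi : m i ≠ n i) : (m i : ℕ∞) ≤ d i := by
  by_contra hlt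
  have h1 := coe_meet m d i
  have h2 := coe_meet n d i
  have h3 : m i - meet m d i = n i - meet n d i := congrFun h i
  lift d i to ℕ using ne_top_of_lt (not_le.mp hlt) with e
  rw [← (Nat.mono_cast (α := ℕ∞)).map_min] at h1 h2
  norm_cast at h1 h2 hlt
  omega

/-- A path into `v` of maximal degree below `c`: its source receives no path of degree `e_i` in any
direction `i` where the bound `c` is not attained. -/
theorem exists_path_maximal_deg (G : KGraph k Λ) (v : Λ) (c : Fin k → ℕ) :
    ∃ (w : Λ) (l : w ⟶ v), G.deg l ≤ c ∧
      ∀ i, G.deg l i < c i → G.pathsTo w (Pi.single i 1) = ∅ := by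
  have hfin : {a : Fin k → ℕ | a ≤ c ∧ ∃ (w : Λ) (l : w ⟶ v), G.deg l = a}.Finite :=
    (Set.finite_Iic c).subset fun a ha => ha.1
  obtain ⟨a, ⟨hac, w, l, rfl⟩, hmax⟩ :=
    hfin.exists_maximal ⟨0, fun _ => Nat.zero_le _, v, 𝟙 v, G.deg_id v⟩
  refine ⟨w, l, hac, fun i hi => Set.eq_empty_iff_forall_notMem.mpr ?_⟩
  rintro ⟨b, e⟩ he
  have he : G.deg e = Pi.single i 1 := he
  have hdeg : G.deg (e ≫ l) = Pi.single i 1 + G.deg l := by rw [G.deg_comp, he]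
  have hle : G.deg (e ≫ l) ≤ c := by
    intro j
    rw [hdeg, Pi.add_apply]
    rcases eq_or_ne j i with rfl | hj
    · rw [Pi.single_eq_same, add_comm]; exact hi
    · rw [Pi.single_eq_of_ne hj, zero_add]; exact hac j
  have := hmax ⟨hle, b, e ≫ l, rfl⟩ (by rw [hdeg]; exact le_add_self) i
  rw [hdeg, Pi.add_apply, Pi.single_eq_same, add_comm] at this
  exact Nat.not_succ_le_self _ this

/-- The truncation of `m` by the degree `d` of the concatenation of a path of degree `a` and a
boundary path: in the coordinates marked by `P`, `a` vanishes and `m` is not truncated; in the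
others, `a` already is the truncation of `m`. -/
theorem meet_eq_add {m a : Fin k → ℕ} {d : Fin k → ℕ∞} {P : Fin k → Prop} [DecidablePred P]
    (ha : ∀ i, (a i : ℕ∞) ≤ d i) (hP : ∀ i, P i → a i = 0 ∧ (m i : ℕ∞) ≤ d i)
    (hP' : ∀ i, ¬ P i → a i ≤ m i ∧ (a i < m i → d i = a i)) :
    meet m d = a + fun i => if P i then m i else 0 := by
  funext i
  have h := coe_meet m d i
  rw [Pi.add_apply]
  by_cases hi : P i
  · rw [min_eq_left (hP i hi).2] at h
    rw [if_pos hi, (hP i hi).1, zero_add]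
    exact_mod_cast h
  · rw [if_neg hi, add_zero]
    have hle := (hP' i hi).1
    rcases hle.lt_or_eq with hlt | heq
    · rw [(hP' i hi).2 hlt] at h
      rw [min_eq_right (by exact_mod_cast hle)] at h
      exact_mod_cast h
    · rw [← heq, min_eq_left (ha i)] at h
      exact_mod_cast h

theorem LocalPeriodicityAt.exists_strictPeriodicityAt (hconv : G.LocallyConvex)
    {m n : Fin k → ℕ} (hmn : m ≠ n) {v : Λ} (h : G.LocalPeriodicityAt m n v) :
    ∃ (w : Λ) (p q : Fin k → ℕ), p ≠ q ∧ G.StrictPeriodicityAt p q w := by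
  obtain ⟨w, l, hac, hmax⟩ := G.exists_path_maximal_deg v fun i => if m i = n i then m i else 0
  refine ⟨w, fun i => if m i ≠ n i then m i else 0, fun i => if m i ≠ n i then n i else 0, ?_, ?_⟩
  · obtain ⟨i, hi⟩ := Function.ne_iff.mp hmn
    refine Function.ne_iff.mpr ⟨i, ?_⟩
    simp [hi]
  · intro y hy
    -- write `y` as `σ^a(x)` with `x = ly`, a boundary path with range `v`
    obtain ⟨x, ha, hx, rfl⟩ := BoundaryPath.exists_shift_eq hconv y hy l
    obtain ⟨hsub, hshift⟩ := h x hx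
    have hdeg : ∀ i, G.deg l i < (if m i = n i then m i else 0) → x.degree i = G.deg l i := by
      intro i hi
      exact le_antisymm (tsub_eq_zero_iff_le.mp
        (BoundaryPath.degree_eq_zero _ (hy ▸ hmax i hi))) (ha i)
    have ha0 : ∀ i, m i ≠ n i → G.deg l i = 0 := fun i hi => by
      have := hac i
      simpa [hi] using this
    have ham : ∀ i, ¬ m i ≠ n i → G.deg l i ≤ m i := fun i hi => by
      have := hac i
      simpa [not_not.mp hi] using this
    have hmm := meet_eq_add (P := fun i => m i ≠ n i) ha
      (fun i hi => ⟨ha0 i hi, le_of_sub_meet_eq hsub hi⟩)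
      (fun i hi => ⟨ham i hi, fun hlt => hdeg i (by rwa [if_pos (not_not.mp hi)])⟩)
    have hnn := meet_eq_add (m := n) (P := fun i => m i ≠ n i) ha
      (fun i hi => ⟨ha0 i hi, le_of_sub_meet_eq hsub.symm hi.symm⟩)
      (fun i hi => ⟨not_not.mp hi ▸ ham i hi,
        fun hlt => hdeg i (by rwa [if_pos (not_not.mp hi), not_not.mp hi])⟩)
    have hle : ∀ (b p : Fin k → ℕ), meet b x.degree = G.deg l + p →
        ∀ i, (p i : ℕ∞) ≤ (x.shift (G.deg l) ha).degree i := fun b p hb i => by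
      have h1 := meet_le b x.degree i
      rw [hb, Pi.add_apply, Nat.cast_add, add_comm] at h1
      exact ENat.le_sub_of_add_le_right (ENat.natCast_ne_top _) h1
    refine ⟨hle m _ hmm, hle n _ hnn, ?_⟩
    rw [x.shift_shift _ _ _ ha _ (meet_le m x.degree) hmm,
      x.shift_shift _ _ _ ha _ (meet_le n x.degree) hnn]
    exact hshift

end KGraph

theorem mainTheorem8 {k : ℕ} (hk : 1 ≤ k) {Λ : Type u} [Category.{v} Λ] (G : KGraph k Λ)
    (hrow : G.RowFinite) (hconv : G.LocallyConvex) :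
    ((∃ (w : Λ) (m n : Fin k → ℕ), m ≠ n ∧ G.LocalPeriodicityAt m n w) ↔
      ∃ (w : Λ) (p q : Fin k → ℕ), p ≠ q ∧ G.StrictPeriodicityAt p q w) ∧
    (G.NoLocalPeriodicity ↔
      ∀ (w : Λ) (p q : Fin k → ℕ), p ≠ q → ¬ G.StrictPeriodicityAt p q w) := by
  have key : (∃ (w : Λ) (m n : Fin k → ℕ), m ≠ n ∧ G.LocalPeriodicityAt m n w) ↔
      ∃ (w : Λ) (p q : Fin k → ℕ), p ≠ q ∧ G.StrictPeriodicityAt p q w :=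
    ⟨fun ⟨_, _, _, hmn, h⟩ => h.exists_strictPeriodicityAt hconv hmn,
      fun ⟨w, p, q, hpq, h⟩ => ⟨w, p, q, hpq, h.localPeriodicityAt⟩⟩
  refine ⟨key, ?_⟩
  have := not_congr key
  push Not at this
  exact this
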